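/- For a nonnegative integer $k$ let $H_k$ be the real vector space of $k\times k$ complex Hermitian matrices, $D_k\subset H_k$ the set of positive semidefinite matrices of trace one, and $P_k\subset D_k$ the set of Hermitian matrices of rank one and trace one (pure states). Let $m,n$ be nonnegative integers, identify $H_{mn}$ with $H_m\otimes H_n$ through the Kronecker product, and put $$P_m\otimes P_n=\{P\otimes Q: P\in P_m,\ Q\in P_n\},\qquad S_{m,n}=\operatorname{conv}\{A\otimes B: A\in D_m,\ B\in D_n\}.$$ Let $\Psi:H_{mn}\to H_{mn}$ be a real-linear map. The following are equivalent: (a) $\Psi(P_m\otimes P_n)=P_m\otimes P_n$; (b) $\Psi(S_{m,n})=S_{m,n}$; (c) there are unitary matrices $U\in M_m(\mathbb C)$ and $V\in M_n(\mathbb C)$, a map $\psi_1:H_m\to H_m$ of the form $A\mapsto UAU^*$ or $A\mapsto UA^{T}U^*$, and a map $\psi_2:H_n\to H_n$ of the form $B\mapsto VBV^*$ or $B\mapsto VB^{T}V^*$, such that either (c.1) $\Psi(A\otimes B)=\psi_1(A)\otimes\psi_2(B)$ for all $A\in H_m$, $B\in H_n$, or (c.2) $m=n$ and $\Psi(A\otimes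 B)=\psi_2(B)\otimes\psi_1(A)$ for all $A\in H_m$, $B\in H_n$. -/

import Mathlib

open scoped Kronecker ComplexOrder

namespace SepStates

/-- The real vector space of complex Hermitian matrices with rows and columns indexed by `ι`. -/
abbrev Herm (ι : Type) : Type := selfAdjoint (Matrix ι ι ℂ)

/-- The Kronecker product `A ⊗ B` of two Hermitian matrices, a Hermitian matrix indexed by
pairs; the Hermitian matrices of order `mn` are those indexed by `Fin m × Fin n`. -/
def kron {m n : ℕ} (A : Herm (Fin m)) (B : Herm (Fin n)) : Herm (Fin m × Fin n) :=
  ⟨(A : Matrix (Fin m) (Fin m) ℂ) ⊗ₖ (B : Matrix (Fin n) (Fin n) ℂ), by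
    have hA := selfAdjoint.mem_iff.1 A.2
    have hB := selfAdjoint.mem_iff.1 B.2
    rw [Matrix.star_eq_conjTranspose] at hA hB
    rw [selfAdjoint.mem_iff, Matrix.star_eq_conjTranspose, Matrix.conjTranspose_kronecker,
      hA, hB]⟩

/-- Density matrices: positive semidefinite of trace one. -/
def density (n : ℕ) : Set (Herm (Fin n)) :=
  {A | (A : Matrix (Fin n) (Fin n) ℂ).PosSemidef ∧ (A : Matrix (Fin n) (Fin n) ℂ).trace = 1}

/-- Pure states: Hermitian matrices of rank one and trace one. -/
def pureStates (n : ℕ) : Set (Herm (Fin n)) :=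
  {A | (A : Matrix (Fin n) (Fin n) ℂ).rank = 1 ∧ (A : Matrix (Fin n) (Fin n) ℂ).trace = 1}

/-- Product pure states `P ⊗ Q` with `P`, `Q` pure. -/
def productPure (m n : ℕ) : Set (Herm (Fin m × Fin n)) :=
  Set.image2 kron (pureStates m) (pureStates n)

/-- Separable states: the convex hull of the products of density matrices. -/
def separable (m n : ℕ) : Set (Herm (Fin m × Fin n)) :=
  convexHull ℝ (Set.image2 kron (density m) (density n))

/-- `ψ` is `A ↦ U A U*` or `A ↦ U Aᵀ U*`. -/
def IsUnitaryForm {n : ℕ} (U : Matrix (Fin n) (Fin n) ℂ)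
    (ψ : Herm (Fin n) → Herm (Fin n)) : Prop :=
  (∀ A : Herm (Fin n), (ψ A : Matrix (Fin n) (Fin n) ℂ) =
      U * (A : Matrix (Fin n) (Fin n) ℂ) * U.conjTranspose) ∨
  (∀ A : Herm (Fin n), (ψ A : Matrix (Fin n) (Fin n) ℂ) =
      U * (A : Matrix (Fin n) (Fin n) ℂ).transpose * U.conjTranspose)

/-- Transport of a Hermitian matrix along an equality of orders (same entries). -/
def castHerm {m n : ℕ} (h : m = n) (A : Herm (Fin m)) : Herm (Fin n) := h ▸ A

end SepStates

/-
A linear bijection of `conv S` onto itself permutes extreme points, and the extreme points of the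
separable states are the product pure states, so (a) and (b) say the same thing.

Suppose `Ψ` permutes the product pure states. Along a pencil of pure states `P_t`, the image
`Ψ (P_t ⊗ Q)` is a quadratic family of product states, which forces one of its two tensor factors
to be constant. Hence each of the maps `P ↦ Ψ (P ⊗ Q)` and `Q ↦ Ψ (P ⊗ Q)` has a constant factor;
surjectivity excludes that they share it, unless that factor is one-dimensional, and `Ψ` splits
as `ψ₁ ⊗ ψ₂` up to a swap, where `ψ₁` and `ψ₂` are linear and map the pure states onto the pure
states.

Such a `ψ` preserves `tr (P Q)`, hence orthogonality of pure states, hence squares by the spectral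
theorem. Its complexification is therefore a Jordan automorphism of a prime ring, so by Herstein's
theorem it is a star-automorphism or anti-automorphism of the matrix algebra, which is conjugation
by a unitary matrix, preceded by a transposition in the second case.
-/

namespace SepStates

open Matrix

section ExtremePoints

theorem injOn_span_of_image_eq {K E : Type*} [DivisionRing K] [AddCommGroup E] [Module K E]
    [FiniteDimensional K E] {f : E →ₗ[K] E} {S : Set E} (h : f '' S = S) :
    Set.InjOn f (Submodule.span K S) := by
  have hmap : (Submodule.span K S).map f = Submodule.span K S := by rw [Submodule.map_span, h]
  have hmem : ∀ x ∈ Submodule.span K S, f x ∈ Submodule.span K S := fun x hx =>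
    hmap.le (Submodule.mem_map_of_mem hx)
  have hsurj : Function.Surjective (f.restrict hmem) := by
    rintro ⟨y, hy⟩
    obtain ⟨x, hx, rfl⟩ := hmap.ge hy
    exact ⟨⟨x, hx⟩, rfl⟩
  intro x hx y hy hxy
  exact congrArg Subtype.val <|
    LinearMap.injective_iff_surjective.2 hsurj (a₁ := ⟨x, hx⟩) (a₂ := ⟨y, hy⟩) (Subtype.ext hxy)

theorem image_extremePoints_of_image_eq {𝕜 E : Type*} [Field 𝕜] [LinearOrder 𝕜]
    [IsStrictOrderedRing 𝕜] [AddCommGroup E] [Module 𝕜 E] [FiniteDimensional 𝕜 E]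
    {f : E →ₗ[𝕜] E} {S : Set E} (h : f '' S = S) :
    f '' S.extremePoints 𝕜 = S.extremePoints 𝕜 := by
  have hinj := injOn_span_of_image_eq h
  have hspan : S ⊆ Submodule.span 𝕜 S := Submodule.subset_span
  ext z
  simp only [Set.mem_image, mem_extremePoints_iff_left]
  constructor
  · rintro ⟨x, ⟨hx, hext⟩, rfl⟩
    refine ⟨h.le ⟨x, hx, rfl⟩, fun y₁ hy₁ y₂ hy₂ hseg => ?_⟩
    obtain ⟨x₁, hx₁, rfl⟩ := h.ge hy₁
    obtain ⟨x₂, hx₂, rfl⟩ := h.ge hy₂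
    obtain ⟨a, b, ha, hb, hab, hxy⟩ := hseg
    rw [← map_smul, ← map_smul, ← map_add] at hxy
    have hmem : a • x₁ + b • x₂ ∈ Submodule.span 𝕜 S :=
      add_mem (Submodule.smul_mem _ a (hspan hx₁)) (Submodule.smul_mem _ b (hspan hx₂))
    rw [hext x₁ hx₁ x₂ hx₂ ⟨a, b, ha, hb, hab, hinj hmem (hspan hx) hxy⟩]
  · rintro ⟨hz, hext⟩
    obtain ⟨x, hx, rfl⟩ := h.ge hz
    refine ⟨x, ⟨hx, fun x₁ hx₁ x₂ hx₂ hseg => ?_⟩, rfl⟩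
    refine hinj (hspan hx₁) (hspan hx)
      (hext _ (h.le ⟨x₁, hx₁, rfl⟩) _ (h.le ⟨x₂, hx₂, rfl⟩) ?_)
    exact (image_openSegment 𝕜 f.toAffineMap x₁ x₂).le ⟨x, hseg, rfl⟩

theorem bilinForm_convex_combination {R E : Type*} [CommRing R] [AddCommGroup E] [Module R E]
    (B : LinearMap.BilinForm R E) (x y : E) {a b : R} (hab : a + b = 1) :
    B (a • x + b • y) (a • x + b • y) =
      a * B x x + b * B y y - a * b * B (x - y) (x - y) := by
  obtain rfl : b = 1 - a := eq_sub_of_add_eq' hab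
  simp only [map_add, map_sub, map_smul, LinearMap.add_apply, LinearMap.sub_apply,
    LinearMap.smul_apply, smul_eq_mul]
  ring

theorem extremePoints_convexHull_of_forall_eq_one {E : Type*} [AddCommGroup E] [Module ℝ E]
    (B : LinearMap.BilinForm ℝ E) (hB : ∀ x, x ≠ 0 → 0 < B x x) {S : Set E}
    (hS : ∀ x ∈ S, B x x = 1) : (convexHull ℝ S).extremePoints ℝ = S := by
  have hnonneg : ∀ x, 0 ≤ B x x := fun x => by
    rcases eq_or_ne x 0 with rfl | hx
    · simp
    · exact (hB x hx).le
  have hle : ∀ x ∈ convexHull ℝ S, B x x ≤ 1 := by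
    refine convexHull_min (t := {x | B x x ≤ 1}) (fun x hx => (hS x hx).le) ?_
    intro x (hx : B x x ≤ 1) y (hy : B y y ≤ 1) a b ha hb hab
    change B (a • x + b • y) (a • x + b • y) ≤ 1
    rw [bilinForm_convex_combination B x y hab]
    have := mul_nonneg (mul_nonneg ha hb) (hnonneg (x - y))
    nlinarith
  refine extremePoints_convexHull_subset.antisymm fun z hz => ?_
  rw [mem_extremePoints_iff_left]
  refine ⟨subset_convexHull ℝ S hz, ?_⟩
  rintro x hx y hy ⟨a, b, ha, hb, hab, rfl⟩
  have hone := hS _ hz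
  rw [bilinForm_convex_combination B x y hab] at hone
  obtain rfl : x = y := by
    by_contra hne
    have := mul_pos (mul_pos ha hb) (hB _ (sub_ne_zero.2 hne))
    nlinarith [hle x hx, hle y hy]
  rw [← add_smul, hab, one_smul]

end ExtremePoints

section Jordan

theorem addMonoidHom_eq_zero_or_eq_zero {M N P : Type*} [AddZeroClass M] [AddZeroClass N]
    [AddZeroClass P] {f : M →+ N} {g : M →+ P} (h : ∀ a, f a = 0 ∨ g a = 0) :
    f = 0 ∨ g = 0 := by
  by_contra! hne
  obtain ⟨a, ha⟩ := DFunLike.ne_iff.1 hne.1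
  obtain ⟨b, hb⟩ := DFunLike.ne_iff.1 hne.2
  have hga := (h a).resolve_left ha
  have hfb := (h b).resolve_right hb
  rcases h (a + b) with hab | hab
  · exact ha (by simpa [hfb] using hab)
  · exact hb (by simpa [hga] using hab)

/-- Prime rings: `u B v = 0` forces `u = 0` or `v = 0`. -/
def IsPrimeRing (B : Type*) [Ring B] : Prop :=
  ∀ u v : B, (∀ x, u * x * v = 0) → u = 0 ∨ v = 0

theorem isPrimeRing_matrix (ι K : Type*) [Fintype ι] [DecidableEq ι] [Ring K] [NoZeroDivisors K] :
    IsPrimeRing (Matrix ι ι K) := by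
  intro u v h
  by_contra! hne
  obtain ⟨i, j, hu⟩ : ∃ i j, u i j ≠ 0 := by
    by_contra! h0
    exact hne.1 (Matrix.ext h0)
  obtain ⟨k, l, hv⟩ : ∃ k l, v k l ≠ 0 := by
    by_contra! h0
    exact hne.2 (Matrix.ext h0)
  have := congrFun (congrFun (h (single j k 1)) i) l
  rw [Matrix.mul_apply, Finset.sum_eq_single k] at this
  · simp_all
  · intro b _ hb
    rw [mul_single_apply_of_ne _ _ _ _ _ hb, zero_mul]
  · simp

/-- `φ` preserves squares; for additive maps between rings in which `2` is not a zero divisor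
these are the homomorphisms of the Jordan product `a b + b a`. -/
def IsJordanHom {A B : Type*} [Ring A] [Ring B] (φ : A →+ B) : Prop :=
  ∀ a, φ (a * a) = φ a * φ a

namespace IsJordanHom

variable {A B : Type*} [Ring A] [Ring B] {φ : A →+ B}

theorem map_mul_add_mul (h : IsJordanHom φ) (a b : A) :
    φ (a * b + b * a) = φ a * φ b + φ b * φ a := by
  have hab := h (a + b)
  simp only [add_mul, mul_add, map_add, h a, h b] at hab ⊢
  linear_combination (norm := noncomm_ring) hab

variable [IsAddTorsionFree B]

theorem map_mul_mul_self (h : IsJordanHom φ) (a b : A) :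
    φ (a * b * a) = φ a * φ b * φ a := by
  have hsq := h.map_mul_add_mul (a * a) b
  have hab := h.map_mul_add_mul a (a * b + b * a)
  rw [h.map_mul_add_mul a b] at hab
  rw [h a] at hsq
  have key : 2 • (a * b * a) =
      a * (a * b + b * a) + (a * b + b * a) * a - (a * a * b + b * (a * a)) := by noncomm_ring
  refine nsmul_right_injective two_ne_zero ?_
  beta_reduce
  rw [← map_nsmul, key, map_sub, hab, hsq]
  noncomm_ring

theorem map_mul_mul_add (h : IsJordanHom φ) (a b c : A) :
    φ (a * b * c + c * b * a) = φ a * φ b * φ c + φ c * φ b * φ a := by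
  have hac := h.map_mul_mul_self (a + c) b
  simp only [add_mul, mul_add, map_add, h.map_mul_mul_self a b, h.map_mul_mul_self c b] at hac ⊢
  linear_combination (norm := noncomm_ring) hac

theorem defect_mul_mul_defect (h : IsJordanHom φ) (a b x : A) :
    (φ (a * b) - φ a * φ b) * φ x * (φ (a * b) - φ b * φ a) +
      (φ (a * b) - φ b * φ a) * φ x * (φ (a * b) - φ a * φ b) = 0 := by
  have hba : φ (b * a) = φ a * φ b + φ b * φ a - φ (a * b) := by
    rw [← h.map_mul_add_mul a b, map_add, add_sub_cancel_left]
  have h₁ := h.map_mul_mul_add (a * b) x (b * a)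
  have h₂ : φ (a * b * x * (b * a) + b * a * x * (a * b)) =
      φ a * (φ b * φ x * φ b) * φ a + φ b * (φ a * φ x * φ a) * φ b := by
    rw [← h.map_mul_mul_self b x, ← h.map_mul_mul_self a x, ← h.map_mul_mul_self a,
      ← h.map_mul_mul_self b, ← map_add]
    congr 1
    noncomm_ring
  rw [h₁, hba] at h₂
  linear_combination (norm := noncomm_ring) -h₂

end IsJordanHom

theorem IsPrimeRing.eq_zero_or_eq_zero {B : Type*} [Ring B] [IsAddTorsionFree B]
    (hB : IsPrimeRing B) {u v : B} (h : ∀ x, u * x * v + v * x * u = 0) : u = 0 ∨ v = 0 := by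
  refine hB u v fun x => ?_
  have hswap : ∀ y, v * y * u = -(u * y * v) := fun y => eq_neg_of_add_eq_zero_right (h y)
  have hsq : ∀ y, u * x * v * y * (u * x * v) = 0 := fun y => by
    refine nsmul_right_injective two_ne_zero ?_
    have e : u * x * v * y * (u * x * v) = - (u * x * v * y * (u * x * v)) :=
      calc u * x * v * y * (u * x * v) = u * x * (v * y * u) * x * v := by noncomm_ring
        _ = - (u * (x * u * y) * v * x * v) := by rw [hswap]; noncomm_ring
        _ = v * (x * u * y) * u * x * v := by rw [hswap]; noncomm_ring
        _ = v * x * u * y * (u * x * v) := by noncomm_ring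
        _ = _ := by rw [hswap]; noncomm_ring
    simp only [two_nsmul, smul_zero]
    exact add_eq_zero_iff_eq_neg.2 e
  rcases hB _ _ hsq with h0 | h0 <;> exact h0

theorem IsJordanHom.map_mul_or_map_mul_swap {A B : Type*} [Ring A] [Ring B] [IsAddTorsionFree B]
    {φ : A →+ B} (h : IsJordanHom φ) (hφ : Function.Surjective φ) (hB : IsPrimeRing B) :
    (∀ a b, φ (a * b) = φ a * φ b) ∨ ∀ a b, φ (a * b) = φ b * φ a := by
  let u : A →+ A →+ B := AddMonoidHom.mul.compr₂ φ - (AddMonoidHom.mul.comp φ).compl₂ φ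
  let v : A →+ A →+ B := AddMonoidHom.mul.compr₂ φ - ((AddMonoidHom.mul.comp φ).compl₂ φ).flip
  have huv : ∀ a b, u a b = 0 ∨ v a b = 0 := fun a b =>
    hB.eq_zero_or_eq_zero (hφ.forall.2 (h.defect_mul_mul_defect a b))
  refine (addMonoidHom_eq_zero_or_eq_zero fun a => addMonoidHom_eq_zero_or_eq_zero (huv a)).imp
    (fun hu a b => ?_) fun hv a b => ?_
  · exact sub_eq_zero.1 (DFunLike.congr_fun (DFunLike.congr_fun hu a) b)
  · exact sub_eq_zero.1 (DFunLike.congr_fun (DFunLike.congr_fun hv a) b)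

end Jordan

section TraceForm

variable {ι : Type}

theorem Herm.isHermitian (A : Herm ι) : (A : Matrix ι ι ℂ).IsHermitian :=
  selfAdjoint.mem_iff.1 A.2

instance [Finite ι] : Module.Finite ℝ (Herm ι) :=
  have : Module.Finite ℝ (Matrix ι ι ℂ) := Module.Finite.trans ℂ _
  Module.Finite.of_surjective (realPart (A := Matrix ι ι ℂ)) realPart_surjective

variable [Fintype ι]

/-- The real inner product `(A, B) ↦ tr (A B)` on Hermitian matrices; the trace is real, and `re`
only moves it to `ℝ`. -/
noncomputable def traceForm : LinearMap.BilinForm ℝ (Herm ι) :=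
  LinearMap.mk₂ ℝ (fun A B => ((A : Matrix ι ι ℂ) * (B : Matrix ι ι ℂ)).trace.re)
    (fun A A' B => by simp [add_mul])
    (fun c A B => by simp)
    (fun A B B' => by simp [mul_add])
    (fun c A B => by simp)

theorem traceForm_apply (A B : Herm ι) :
    traceForm A B = ((A : Matrix ι ι ℂ) * (B : Matrix ι ι ℂ)).trace.re := rfl

theorem traceForm_comm (A B : Herm ι) : traceForm A B = traceForm B A := by
  rw [traceForm_apply, traceForm_apply, trace_mul_comm]

theorem coe_traceForm (A B : Herm ι) :
    (traceForm A B : ℂ) = ((A : Matrix ι ι ℂ) * (B : Matrix ι ι ℂ)).trace := by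
  rw [traceForm_apply, ← Complex.conj_eq_iff_re, ← Complex.star_def, ← trace_conjTranspose,
    conjTranspose_mul, A.isHermitian, B.isHermitian, trace_mul_comm]

theorem coe_traceForm_one [DecidableEq ι] (A : Herm ι) :
    (traceForm 1 A : ℂ) = (A : Matrix ι ι ℂ).trace := by
  rw [coe_traceForm, selfAdjoint.val_one, one_mul]

theorem traceForm_self_nonneg (A : Herm ι) : 0 ≤ traceForm A A := by
  have h := (posSemidef_conjTranspose_mul_self (A : Matrix ι ι ℂ)).trace_nonneg
  rwa [A.isHermitian, ← coe_traceForm, Complex.zero_le_real] at h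

theorem traceForm_self_eq_zero {A : Herm ι} : traceForm A A = 0 ↔ A = 0 := by
  have h := trace_conjTranspose_mul_self_eq_zero_iff (A := (A : Matrix ι ι ℂ))
  rwa [A.isHermitian, ← coe_traceForm, Complex.ofReal_eq_zero, ZeroMemClass.coe_eq_zero] at h

theorem traceForm_self_pos {A : Herm ι} (hA : A ≠ 0) : 0 < traceForm A A :=
  (traceForm_self_nonneg A).lt_of_ne' (traceForm_self_eq_zero.not.2 hA)

theorem traceForm_nondegenerate : (traceForm (ι := ι)).Nondegenerate :=
  ⟨fun A h => traceForm_self_eq_zero.1 (h A), fun A h => traceForm_self_eq_zero.1 (h A)⟩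

theorem exists_traceForm_eq (l : Herm ι →ₗ[ℝ] ℝ) : ∃ X : Herm ι, ∀ A, traceForm X A = l A :=
  ⟨(traceForm.toDual traceForm_nondegenerate).symm l, fun _ =>
    LinearMap.BilinForm.apply_toDual_symm_apply ..⟩

end TraceForm

section RankOne

variable {ι : Type}

/-- The Hermitian matrix `x x*`, for any vector `x`. -/
def rankOne (x : ι → ℂ) : Herm ι :=
  ⟨vecMulVec x (star x), by
    rw [selfAdjoint.mem_iff, star_eq_conjTranspose, conjTranspose_vecMulVec, star_star]⟩

theorem coe_rankOne (x : ι → ℂ) : (rankOne x : Matrix ι ι ℂ) = vecMulVec x (star x) := rfl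

theorem rankOne_smul (c : ℂ) (x : ι → ℂ) :
    rankOne (c • x) = Complex.normSq c • rankOne x := by
  ext i j
  change c * x i * star (c * x j) = Complex.normSq c • (x i * star (x j))
  rw [Complex.real_smul, Complex.normSq_eq_conj_mul_self, star_mul', Complex.star_def]
  ring

theorem rankOne_add_smul (x y : ι → ℂ) (t : ℝ) :
    rankOne (x + (t : ℂ) • y) =
      rankOne x + t • (rankOne (x + y) - rankOne x - rankOne y) + t ^ 2 • rankOne y := by
  ext i j
  change (x i + t * y i) * star (x j + t * y j) = x i * star (x j) +
    t • ((x i + y i) * star (x j + y j) - x i * star (x j) - y i * star (y j)) +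
      t ^ 2 • (y i * star (y j))
  simp only [Complex.real_smul, star_add, star_mul', Complex.star_def, Complex.conj_ofReal]
  push_cast
  ring

variable [Fintype ι]

theorem trace_rankOne (x : ι → ℂ) : (rankOne x : Matrix ι ι ℂ).trace = star x ⬝ᵥ x := by
  rw [coe_rankOne, trace_vecMulVec, dotProduct_comm]

theorem rankOne_mul_rankOne (x y : ι → ℂ) :
    (rankOne x * rankOne y : Matrix ι ι ℂ) = (star x ⬝ᵥ y) • vecMulVec x (star y) := by
  rw [coe_rankOne, coe_rankOne, vecMulVec_mul_vecMulVec, vecMulVec_smul]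

theorem coe_traceForm_rankOne (A : Herm ι) (x : ι → ℂ) :
    (traceForm A (rankOne x) : ℂ) = star x ⬝ᵥ (A : Matrix ι ι ℂ) *ᵥ x := by
  rw [coe_traceForm, coe_rankOne, mul_vecMulVec, trace_vecMulVec, dotProduct_comm]

theorem posSemidef_iff_traceForm_rankOne_nonneg {A : Herm ι} :
    (A : Matrix ι ι ℂ).PosSemidef ↔ ∀ x, 0 ≤ traceForm A (rankOne x) := by
  simp_rw [posSemidef_iff_dotProduct_mulVec, ← coe_traceForm_rankOne, Complex.zero_le_real,
    A.isHermitian, true_and]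

theorem traceForm_one_rankOne_pos [DecidableEq ι] {x : ι → ℂ} (hx : x ≠ 0) :
    0 < traceForm 1 (rankOne x) := by
  rw [← Complex.zero_lt_real, coe_traceForm_one, trace_rankOne]
  exact dotProduct_star_self_pos_iff.2 hx

theorem Herm.exists_spectral [DecidableEq ι] (A : Herm ι) :
    ∃ u : ι → ι → ℂ, (∀ i j, star (u i) ⬝ᵥ u j = (1 : Matrix ι ι ℂ) i j) ∧
      A = ∑ i, A.isHermitian.eigenvalues i • rankOne (u i) := by
  let W := A.isHermitian.eigenvectorUnitary
  refine ⟨W.1.col, fun i j => ?_, ?_⟩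
  · exact congrFun (congrFun (mem_unitaryGroup_iff'.1 W.2) i) j
  · ext a b
    have h := congrFun (congrFun A.isHermitian.spectral_theorem a) b
    rw [Unitary.conjStarAlgAut_apply, mul_apply] at h
    rw [h, AddSubgroup.val_finsetSum, Matrix.sum_apply]
    refine Finset.sum_congr rfl fun i _ => ?_
    rw [mul_diagonal, star_apply]
    change W.1 a i * (A.isHermitian.eigenvalues i : ℂ) * star (W.1 b i) =
      A.isHermitian.eigenvalues i • (W.1 a i * star (W.1 b i))
    rw [Complex.real_smul]
    ring

end RankOne

section PureStates

variable {n : ℕ}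

theorem mem_pureStates_iff {A : Herm (Fin n)} :
    A ∈ pureStates n ↔ ∃ x : Fin n → ℂ, star x ⬝ᵥ x = 1 ∧ A = rankOne x := by
  constructor
  · rintro ⟨hrank, htrace⟩
    obtain ⟨u, hu, hA⟩ := A.exists_spectral
    rw [A.isHermitian.rank_eq_card_non_zero_eigs, Fintype.card_eq_one_iff] at hrank
    obtain ⟨⟨i, hi⟩, huniq⟩ := hrank
    have hzero : ∀ j ≠ i, A.isHermitian.eigenvalues j = 0 := fun j hj => by
      by_contra h
      exact hj (congrArg Subtype.val (huniq ⟨j, h⟩))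
    rw [A.isHermitian.trace_eq_sum_eigenvalues,
      Fintype.sum_eq_single i fun j hj => by simp [hzero j hj]] at htrace
    have hone : A.isHermitian.eigenvalues i = 1 := Complex.ofReal_eq_one.1 htrace
    refine ⟨u i, (hu i i).trans (one_apply_eq i), hA.trans ?_⟩
    rw [Fintype.sum_eq_single i fun j hj => by simp [hzero j hj], hone, one_smul]
  · rintro ⟨x, hx, rfl⟩
    refine ⟨le_antisymm (rank_vecMulVec_le _ _) (Nat.one_le_iff_ne_zero.2 fun hrank => ?_),
      (trace_rankOne x).trans hx⟩
    have hzero := LinearMap.range_eq_bot.1 (Submodule.finrank_eq_zero.1 hrank)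
    have hmulVec : (rankOne x : Matrix (Fin n) (Fin n) ℂ) *ᵥ x = 0 := LinearMap.congr_fun hzero x
    rw [coe_rankOne, vecMulVec_mulVec, hx, MulOpposite.op_one, one_smul] at hmulVec
    simp [hmulVec] at hx

theorem rankOne_mem_pureStates {x : Fin n → ℂ} (hx : star x ⬝ᵥ x = 1) :
    rankOne x ∈ pureStates n := mem_pureStates_iff.2 ⟨x, hx, rfl⟩

theorem traceForm_one_of_mem_pureStates {P : Herm (Fin n)} (hP : P ∈ pureStates n) :
    traceForm 1 P = 1 :=
  Complex.ofReal_injective ((coe_traceForm_one P).trans hP.2)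

theorem exists_pureState_smul_eq_rankOne {x : Fin n → ℂ} (hx : x ≠ 0) :
    ∃ P ∈ pureStates n, rankOne x = traceForm 1 (rankOne x) • P := by
  set t := traceForm 1 (rankOne x) with ht
  have hpos : 0 < t := traceForm_one_rankOne_pos hx
  have hscale : rankOne (((√t)⁻¹ : ℂ) • x) = t⁻¹ • rankOne x := by
    rw [rankOne_smul, ← Complex.ofReal_inv, Complex.normSq_ofReal, ← mul_inv,
      Real.mul_self_sqrt hpos.le]
  refine ⟨t⁻¹ • rankOne x, ?_, (smul_inv_smul₀ hpos.ne' _).symm⟩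
  rw [← hscale]
  apply rankOne_mem_pureStates
  rw [← trace_rankOne, hscale, ← coe_traceForm_one, map_smul, ← ht, smul_eq_mul,
    inv_mul_cancel₀ hpos.ne', Complex.ofReal_one]

theorem span_pureStates : Submodule.span ℝ (pureStates n) = ⊤ := by
  rw [eq_top_iff]
  intro A _
  obtain ⟨u, hu, hA⟩ := A.exists_spectral
  rw [hA]
  exact Submodule.sum_mem _ fun i _ => Submodule.smul_mem _ _ <|
    Submodule.subset_span (rankOne_mem_pureStates ((hu i i).trans (one_apply_eq i)))

theorem pureStates_nonempty [NeZero n] : (pureStates n).Nonempty :=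
  ⟨rankOne (Pi.single 0 1), rankOne_mem_pureStates (by simp)⟩

theorem traceForm_pure_self {P : Herm (Fin n)} (hP : P ∈ pureStates n) : traceForm P P = 1 := by
  obtain ⟨x, hx, rfl⟩ := mem_pureStates_iff.1 hP
  apply Complex.ofReal_injective
  rw [coe_traceForm, rankOne_mul_rankOne, hx, one_smul, ← coe_rankOne, trace_rankOne, hx,
    Complex.ofReal_one]

theorem density_eq_convexHull : density n = convexHull ℝ (pureStates n) := by
  refine Set.Subset.antisymm ?_ (convexHull_min ?_ ?_)
  · rintro A ⟨hA, htrace⟩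
    obtain ⟨u, hu, hsum⟩ := A.exists_spectral
    rw [A.isHermitian.trace_eq_sum_eigenvalues] at htrace
    rw [hsum]
    refine (convex_convexHull ℝ _).sum_mem (fun i _ => hA.eigenvalues_nonneg i)
      (Complex.ofReal_injective ((Complex.ofReal_sum _ _).trans htrace)) fun i _ => ?_
    exact subset_convexHull ℝ _ (rankOne_mem_pureStates ((hu i i).trans (one_apply_eq i)))
  · intro A hA
    obtain ⟨x, -, rfl⟩ := mem_pureStates_iff.1 hA
    exact ⟨posSemidef_vecMulVec_self_star x, hA.2⟩
  · rintro A ⟨hA, hA1⟩ B ⟨hB, hB1⟩ a b ha hb hab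
    refine ⟨(hA.smul ha).add (hB.smul hb), ?_⟩
    simp [hA1, hB1, ← Complex.ofReal_add, hab]

end PureStates

section Kron

variable {m n : ℕ}

theorem coe_kron (A : Herm (Fin m)) (B : Herm (Fin n)) :
    (kron A B : Matrix (Fin m × Fin n) (Fin m × Fin n) ℂ) =
      (A : Matrix (Fin m) (Fin m) ℂ) ⊗ₖ (B : Matrix (Fin n) (Fin n) ℂ) := rfl

/-- The Kronecker product as a real bilinear map. -/
noncomputable def kronₗ (m n : ℕ) : Herm (Fin m) →ₗ[ℝ] Herm (Fin n) →ₗ[ℝ] Herm (Fin m × Fin n) :=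
  LinearMap.mk₂ ℝ kron
    (fun A A' B => Subtype.ext (by simp [coe_kron, add_kronecker]))
    (fun c A B => Subtype.ext (by simp [coe_kron, smul_kronecker]))
    (fun A B B' => Subtype.ext (by simp [coe_kron, kronecker_add]))
    (fun c A B => Subtype.ext (by simp [coe_kron, kronecker_smul]))

theorem kronₗ_apply (A : Herm (Fin m)) (B : Herm (Fin n)) : kronₗ m n A B = kron A B := rfl

theorem traceForm_kron (A C : Herm (Fin m)) (B D : Herm (Fin n)) :
    traceForm (kron A B) (kron C D) = traceForm A C * traceForm B D := by
  apply Complex.ofReal_injective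
  rw [Complex.ofReal_mul, coe_traceForm, coe_traceForm, coe_traceForm, coe_kron, coe_kron,
    ← mul_kronecker_mul, trace_kronecker]

/-- The partial trace over the second factor. -/
def ptraceRight (m n : ℕ) : Herm (Fin m × Fin n) →ₗ[ℝ] Herm (Fin m) where
  toFun X := ⟨of fun i j => ∑ k, X.1 (i, k) (j, k), by
    ext i j
    simp only [star_apply, of_apply, star_sum, X.isHermitian.apply]⟩
  map_add' X Y := by
    ext i j
    simp [Finset.sum_add_distrib]
  map_smul' c X := by
    ext i j
    simp [Finset.mul_sum]

/-- The partial trace over the first factor. -/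
def ptraceLeft (m n : ℕ) : Herm (Fin m × Fin n) →ₗ[ℝ] Herm (Fin n) where
  toFun X := ⟨of fun i j => ∑ k, X.1 (k, i) (k, j), by
    ext i j
    simp only [star_apply, of_apply, star_sum, X.isHermitian.apply]⟩
  map_add' X Y := by
    ext i j
    simp [Finset.sum_add_distrib]
  map_smul' c X := by
    ext i j
    simp [Finset.mul_sum]

theorem ptraceRight_kron (A : Herm (Fin m)) {B : Herm (Fin n)} (hB : B.1.trace = 1) :
    ptraceRight m n (kron A B) = A := by
  ext i j
  change ∑ k, A.1 i j * B.1 k k = A.1 i j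
  rw [← Finset.mul_sum]
  exact (congrArg _ hB).trans (mul_one _)

theorem ptraceLeft_kron {A : Herm (Fin m)} (B : Herm (Fin n)) (hA : A.1.trace = 1) :
    ptraceLeft m n (kron A B) = B := by
  ext i j
  change ∑ k, A.1 k k * B.1 i j = B.1 i j
  rw [← Finset.sum_mul]
  exact (congrArg (· * _) hA).trans (one_mul _)

theorem mem_productPure_iff {X : Herm (Fin m × Fin n)} :
    X ∈ productPure m n ↔ ptraceRight m n X ∈ pureStates m ∧ ptraceLeft m n X ∈ pureStates n ∧
      kron (ptraceRight m n X) (ptraceLeft m n X) = X := by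
  constructor
  · rintro ⟨P, hP, Q, hQ, rfl⟩
    rw [ptraceRight_kron P hQ.2, ptraceLeft_kron Q hP.2]
    exact ⟨hP, hQ, rfl⟩
  · rintro ⟨hP, hQ, h⟩
    exact ⟨_, hP, _, hQ, h⟩

theorem ext_pureStates {E : Type*} [AddCommGroup E] [Module ℝ E]
    {f g : Herm (Fin m) →ₗ[ℝ] Herm (Fin n) →ₗ[ℝ] E}
    (h : ∀ P ∈ pureStates m, ∀ Q ∈ pureStates n, f P Q = g P Q) : f = g :=
  LinearMap.ext_on span_pureStates fun P hP =>
    LinearMap.ext_on span_pureStates fun Q hQ => h P hP Q hQ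

end Kron

section Separable

variable {m n : ℕ}

theorem separable_eq_convexHull : separable m n = convexHull ℝ (productPure m n) := by
  rw [separable, density_eq_convexHull, density_eq_convexHull]
  refine Set.Subset.antisymm (convexHull_min ?_ (convex_convexHull ℝ _)) <|
    convexHull_mono (Set.image2_subset (subset_convexHull ℝ _) (subset_convexHull ℝ _))
  rintro _ ⟨A, hA, B, hB, rfl⟩
  have hpure : ∀ P ∈ pureStates m, kron P B ∈ convexHull ℝ (productPure m n) := fun P hP =>
    convexHull_min (t := kronₗ m n P ⁻¹' convexHull ℝ (productPure m n))
      (fun Q hQ => subset_convexHull ℝ _ ⟨P, hP, Q, hQ, rfl⟩)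
      ((convex_convexHull ℝ _).linear_preimage _) hB
  exact convexHull_min (t := (kronₗ m n).flip B ⁻¹' convexHull ℝ (productPure m n)) hpure
    ((convex_convexHull ℝ _).linear_preimage _) hA

theorem extremePoints_separable : (separable m n).extremePoints ℝ = productPure m n := by
  rw [separable_eq_convexHull]
  refine extremePoints_convexHull_of_forall_eq_one traceForm (fun _ => traceForm_self_pos) ?_
  rintro _ ⟨P, hP, Q, hQ, rfl⟩
  rw [traceForm_kron, traceForm_pure_self hP, traceForm_pure_self hQ, one_mul]

theorem image_productPure_eq_iff_image_separable_eq
    (Ψ : Herm (Fin m × Fin n) →ₗ[ℝ] Herm (Fin m × Fin n)) :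
    Ψ '' productPure m n = productPure m n ↔ Ψ '' separable m n = separable m n := by
  refine ⟨fun h => ?_, fun h => ?_⟩
  · rw [separable_eq_convexHull, LinearMap.image_convexHull, h]
  · rw [← extremePoints_separable]
    exact image_extremePoints_of_image_eq h

end Separable

section Pencil

open Polynomial

variable {ι : Type}

/-- The real quadratic polynomial `t ↦ l ((x + t y)(x + t y)*)`, for a real functional `l` on
Hermitian matrices. -/
noncomputable def pencil (l : Herm ι →ₗ[ℝ] ℝ) (x y : ι → ℂ) : ℝ[X] :=
  C (l (rankOne y)) * X ^ 2 + C (l (rankOne (x + y) - rankOne x - rankOne y)) * X +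
    C (l (rankOne x))

theorem eval_pencil (l : Herm ι →ₗ[ℝ] ℝ) (x y : ι → ℂ) (t : ℝ) :
    (pencil l x y).eval t = l (rankOne (x + (t : ℂ) • y)) := by
  rw [rankOne_add_smul]
  simp only [pencil, eval_add, eval_mul, eval_C, eval_pow, eval_X, map_add, map_smul, smul_eq_mul]
  ring

theorem coeff_pencil_zero (l : Herm ι →ₗ[ℝ] ℝ) (x y : ι → ℂ) :
    (pencil l x y).coeff 0 = l (rankOne x) := by
  simp [pencil, -map_sub]

theorem coeff_pencil_two (l : Herm ι →ₗ[ℝ] ℝ) (x y : ι → ℂ) :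
    (pencil l x y).coeff 2 = l (rankOne y) := by
  simp [pencil, -map_sub]

theorem irreducible_pencil_traceForm_one [Fintype ι] [DecidableEq ι] {x y : ι → ℂ} (hy : y ≠ 0)
    (hxy : ∀ t : ℝ, x + (t : ℂ) • y ≠ 0) : Irreducible (pencil (traceForm 1) x y) := by
  apply irreducible_of_degree_le_three_of_not_isRoot
  · rw [pencil, natDegree_quadratic (traceForm_one_rankOne_pos hy).ne']
    decide
  · intro t ht
    rw [IsRoot, eval_pencil] at ht
    exact (traceForm_one_rankOne_pos (hxy t)).ne' ht

theorem eq_of_pencil_traceForm_one_dvd [Fintype ι] [DecidableEq ι] {l : Herm ι →ₗ[ℝ] ℝ}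
    {x y : ι → ℂ} (hxy : traceForm 1 (rankOne x) = traceForm 1 (rankOne y)) (hy : y ≠ 0)
    (h : pencil (traceForm 1) x y ∣ pencil l x y) : l (rankOne x) = l (rankOne y) := by
  rcases eq_or_ne (pencil l x y) 0 with h0 | h0
  · rw [← coeff_pencil_zero l x y, ← coeff_pencil_two l x y, h0, coeff_zero, coeff_zero]
  obtain ⟨r, hr⟩ := h
  have hdeg : (pencil l x y).natDegree ≤ 2 := natDegree_quadratic_le
  have hN : (pencil (traceForm 1) x y).natDegree = 2 :=
    natDegree_quadratic (traceForm_one_rankOne_pos hy).ne'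
  rw [hr] at h0
  rw [hr, natDegree_mul (left_ne_zero_of_mul h0) (right_ne_zero_of_mul h0), hN] at hdeg
  rw [← coeff_pencil_zero l x y, ← coeff_pencil_two l x y, hr,
    eq_C_of_natDegree_eq_zero (p := r) (by lia), coeff_mul_C, coeff_mul_C, coeff_pencil_zero,
    coeff_pencil_two, hxy]

variable {n : ℕ}

theorem eq_top_or_eq_top_of_pureStates_subset_union {K₁ K₂ : Submodule ℝ (Herm (Fin n))}
    (h : pureStates n ⊆ K₁ ∪ K₂) : K₁ = ⊤ ∨ K₂ = ⊤ := by
  have hrankOne : ∀ x, rankOne x ∈ K₁ ∨ rankOne x ∈ K₂ := fun x => by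
    rcases eq_or_ne x 0 with rfl | hx
    · exact Or.inl (by convert K₁.zero_mem; ext; simp [coe_rankOne])
    · obtain ⟨P, hP, hxP⟩ := exists_pureState_smul_eq_rankOne hx
      rw [hxP]
      exact (h hP).imp (K₁.smul_mem _) (K₂.smul_mem _)
  have hexists : ∀ K : Submodule ℝ (Herm (Fin n)), K ≠ ⊤ →
      ∃ (l : Herm (Fin n) →ₗ[ℝ] ℝ) (x : Fin n → ℂ), l (rankOne x) ≠ 0 ∧ K ≤ LinearMap.ker l := by
    intro K hK
    have hnot : ¬ pureStates n ⊆ K := fun hsub =>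
      hK (top_le_iff.1 (span_pureStates.ge.trans (Submodule.span_le.2 hsub)))
    obtain ⟨P, hP, hPK⟩ := Set.not_subset.1 hnot
    obtain ⟨x, -, rfl⟩ := mem_pureStates_iff.1 hP
    obtain ⟨l, hl, hKl⟩ := K.exists_le_ker_of_notMem hPK
    exact ⟨l, x, hl, hKl⟩
  by_contra! hne
  obtain ⟨l₁, x, hx, hl₁⟩ := hexists K₁ hne.1
  obtain ⟨l₂, y, hy, hl₂⟩ := hexists K₂ hne.2
  have hmul : pencil l₁ x y * pencil l₂ x y = 0 := Polynomial.funext fun t => by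
    rw [eval_mul, eval_pencil, eval_pencil, eval_zero, mul_eq_zero]
    exact (hrankOne _).imp (fun hz => hl₁ hz) fun hz => hl₂ hz
  rcases mul_eq_zero.1 hmul with h0 | h0
  · exact hx (by rw [← coeff_pencil_zero l₁ x y, h0, coeff_zero])
  · exact hy (by rw [← coeff_pencil_two l₂ x y, h0, coeff_zero])

end Pencil

section Dichotomy

variable {k m n : ℕ}

theorem traceForm_one_smul_map_rankOne {L : Herm (Fin k) →ₗ[ℝ] Herm (Fin m × Fin n)}
    (hL : Set.MapsTo L (pureStates k) (productPure m n)) (x : Fin k → ℂ) :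
    traceForm 1 (rankOne x) • L (rankOne x) =
      kron (ptraceRight m n (L (rankOne x))) (ptraceLeft m n (L (rankOne x))) := by
  rcases eq_or_ne x 0 with rfl | hx
  · have hzero : rankOne (0 : Fin k → ℂ) = 0 := Subtype.ext (by simp [coe_rankOne])
    rw [hzero, map_zero, map_zero, zero_smul, map_zero, ← kronₗ_apply, map_zero,
      LinearMap.zero_apply]
  · obtain ⟨P, hP, hxP⟩ := exists_pureState_smul_eq_rankOne hx
    set t := traceForm 1 (rankOne x)
    rw [hxP, map_smul, map_smul, map_smul, ← kronₗ_apply, map_smul, map_smul,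
      LinearMap.smul_apply, kronₗ_apply, (mem_productPure_iff.1 (hL hP)).2.2]

theorem pencil_mul_pencil {L : Herm (Fin k) →ₗ[ℝ] Herm (Fin m × Fin n)}
    (hL : Set.MapsTo L (pureStates k) (productPure m n)) (A : Herm (Fin m)) (B : Herm (Fin n))
    (x y : Fin k → ℂ) :
    pencil (traceForm 1) x y * pencil (traceForm (kron A B) ∘ₗ L) x y =
      pencil (traceForm A ∘ₗ ptraceRight m n ∘ₗ L) x y *
        pencil (traceForm B ∘ₗ ptraceLeft m n ∘ₗ L) x y :=
  Polynomial.funext fun t => by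
    simp only [Polynomial.eval_mul, eval_pencil, LinearMap.comp_apply]
    rw [← smul_eq_mul, ← map_smul, traceForm_one_smul_map_rankOne hL, traceForm_kron]

theorem ptraceRight_eq_or_ptraceLeft_eq {L : Herm (Fin k) →ₗ[ℝ] Herm (Fin m × Fin n)}
    (hL : Set.MapsTo L (pureStates k) (productPure m n)) {P P' : Herm (Fin k)}
    (hP : P ∈ pureStates k) (hP' : P' ∈ pureStates k) :
    ptraceRight m n (L P) = ptraceRight m n (L P') ∨
      ptraceLeft m n (L P) = ptraceLeft m n (L P') := by
  rcases eq_or_ne P P' with rfl | hne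
  · exact Or.inl rfl
  have htr : traceForm 1 P = traceForm 1 P' := by
    rw [traceForm_one_of_mem_pureStates hP, traceForm_one_of_mem_pureStates hP']
  obtain ⟨x, -, rfl⟩ := mem_pureStates_iff.1 hP
  obtain ⟨y, hy, rfl⟩ := mem_pureStates_iff.1 hP'
  have hy0 : y ≠ 0 := by
    rintro rfl
    simp at hy
  have hxy : ∀ t : ℝ, x + (t : ℂ) • y ≠ 0 := fun t ht => hne <| by
    rw [eq_neg_of_add_eq_zero_left ht, ← neg_smul, rankOne_smul, map_smul, smul_eq_mul,
      traceForm_one_of_mem_pureStates hP', mul_one] at htr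
    rw [eq_neg_of_add_eq_zero_left ht, ← neg_smul, rankOne_smul, htr, one_smul]
  have hprime := (irreducible_pencil_traceForm_one hy0 hxy).prime
  let f := ptraceRight m n ∘ₗ L
  let g := ptraceLeft m n ∘ₗ L
  have hdvd := hprime.dvd_or_dvd <| Dvd.intro _ <|
    pencil_mul_pencil hL (f (rankOne x) - f (rankOne y)) (g (rankOne x) - g (rankOne y)) x y
  refine hdvd.imp (fun hf => ?_) fun hg => ?_
  · have := eq_of_pencil_traceForm_one_dvd htr hy0 hf
    exact sub_eq_zero.1 (traceForm_self_eq_zero.1 (by rw [map_sub]; exact sub_eq_zero.2 this))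
  · have := eq_of_pencil_traceForm_one_dvd htr hy0 hg
    exact sub_eq_zero.1 (traceForm_self_eq_zero.1 (by rw [map_sub]; exact sub_eq_zero.2 this))

end Dichotomy

section Splitting

theorem subsingleton_image_or_subsingleton_image {α β γ : Type*} {s : Set α} {f : α → β} {g : α → γ}
    (h : ∀ a ∈ s, ∀ b ∈ s, f a = f b ∨ g a = g b) :
    (f '' s).Subsingleton ∨ (g '' s).Subsingleton := by
  simp only [Set.Subsingleton, Set.forall_mem_image]
  by_contra! hne
  obtain ⟨⟨a, ha, b, hb, hab⟩, c, hc, d, hd, hcd⟩ := hne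
  have hg : ∀ e ∈ s, g e = g a := fun e he => by
    by_contra hea
    exact hab (((h e he a ha).resolve_right hea).symm.trans ((h e he b hb).resolve_right fun heb =>
      hea (heb.trans ((h a ha b hb).resolve_left hab).symm)))
  exact hcd ((hg c hc).trans (hg d hd).symm)

variable {k l m n : ℕ}

theorem subsingleton_image_pureStates_or {E E' : Type*} [AddCommGroup E] [Module ℝ E]
    [AddCommGroup E'] [Module ℝ E'] {F : Herm (Fin k) →ₗ[ℝ] Herm (Fin l) →ₗ[ℝ] E}
    {G : Herm (Fin k) →ₗ[ℝ] Herm (Fin l) →ₗ[ℝ] E'}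
    (h : ∀ Q ∈ pureStates l, (F.flip Q '' pureStates k).Subsingleton ∨
      (G.flip Q '' pureStates k).Subsingleton) :
    (F '' pureStates k).Subsingleton ∨ (G '' pureStates k).Subsingleton := by
  let K₁ := ⨅ P ∈ pureStates k, ⨅ P' ∈ pureStates k, LinearMap.eqLocus (F P) (F P')
  let K₂ := ⨅ P ∈ pureStates k, ⨅ P' ∈ pureStates k, LinearMap.eqLocus (G P) (G P')
  have hK : pureStates l ⊆ K₁ ∪ K₂ := fun Q hQ => by
    simp only [K₁, K₂, Set.mem_union, SetLike.mem_coe, Submodule.mem_iInf, LinearMap.mem_eqLocus]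
    exact (h Q hQ).imp
      (fun hF P hP P' hP' => hF (Set.mem_image_of_mem _ hP) (Set.mem_image_of_mem _ hP'))
      fun hG P hP P' hP' => hG (Set.mem_image_of_mem _ hP) (Set.mem_image_of_mem _ hP')
  refine (eq_top_or_eq_top_of_pureStates_subset_union hK).imp ?_ ?_ <;>
  · simp only [K₁, K₂, iInf_eq_top, LinearMap.eqLocus_eq_top, Set.Subsingleton,
      Set.forall_mem_image]
    exact fun h P hP P' hP' => h P hP P' hP'

theorem subsingleton_image_ptraceRight_or_ptraceLeft
    {T : Herm (Fin k) →ₗ[ℝ] Herm (Fin l) →ₗ[ℝ] Herm (Fin m × Fin n)}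
    (hT : ∀ P ∈ pureStates k, ∀ Q ∈ pureStates l, T P Q ∈ productPure m n) :
    (T.compr₂ (ptraceRight m n) '' pureStates k).Subsingleton ∨
      (T.compr₂ (ptraceLeft m n) '' pureStates k).Subsingleton :=
  subsingleton_image_pureStates_or fun Q hQ =>
    subsingleton_image_or_subsingleton_image fun _ hP _ hP' =>
      ptraceRight_eq_or_ptraceLeft_eq (L := T.flip Q) (fun P hP => hT P hP Q hQ) hP hP'

theorem exists_eq_kron [NeZero k] [NeZero l]
    {T : Herm (Fin k) →ₗ[ℝ] Herm (Fin l) →ₗ[ℝ] Herm (Fin m × Fin n)}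
    (hT : Set.image2 (fun A B => T A B) (pureStates k) (pureStates l) = productPure m n)
    (hright : (T.flip.compr₂ (ptraceRight m n) '' pureStates l).Subsingleton)
    (hleft : (T.compr₂ (ptraceLeft m n) '' pureStates k).Subsingleton) :
    ∃ (ψ₁ : Herm (Fin k) →ₗ[ℝ] Herm (Fin m)) (ψ₂ : Herm (Fin l) →ₗ[ℝ] Herm (Fin n)),
      ψ₁ '' pureStates k = pureStates m ∧ ψ₂ '' pureStates l = pureStates n ∧
        ∀ A B, T A B = kron (ψ₁ A) (ψ₂ B) := by
  obtain ⟨P₀, hP₀⟩ := pureStates_nonempty (n := k)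
  obtain ⟨Q₀, hQ₀⟩ := pureStates_nonempty (n := l)
  let ψ₁ := T.flip.compr₂ (ptraceRight m n) Q₀
  let ψ₂ := T.compr₂ (ptraceLeft m n) P₀
  have hψ₁ : ∀ Q ∈ pureStates l, ∀ A, ptraceRight m n (T A Q) = ψ₁ A := fun Q hQ =>
    LinearMap.congr_fun (hright (Set.mem_image_of_mem _ hQ) (Set.mem_image_of_mem _ hQ₀))
  have hψ₂ : ∀ P ∈ pureStates k, ∀ B, ptraceLeft m n (T P B) = ψ₂ B := fun P hP =>
    LinearMap.congr_fun (hleft (Set.mem_image_of_mem _ hP) (Set.mem_image_of_mem _ hP₀))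
  have hmem : ∀ P ∈ pureStates k, ∀ Q ∈ pureStates l,
      ψ₁ P ∈ pureStates m ∧ ψ₂ Q ∈ pureStates n ∧ kron (ψ₁ P) (ψ₂ Q) = T P Q := by
    intro P hP Q hQ
    rw [← hψ₁ Q hQ, ← hψ₂ P hP, ← mem_productPure_iff, ← hT]
    exact Set.mem_image2_of_mem hP hQ
  have hsurj : ∀ P' ∈ pureStates m, ∀ Q' ∈ pureStates n,
      P' ∈ ψ₁ '' pureStates k ∧ Q' ∈ ψ₂ '' pureStates l := by
    intro P' hP' Q' hQ'
    obtain ⟨P, hP, Q, hQ, hPQ : T P Q = kron P' Q'⟩ := hT.ge (Set.mem_image2_of_mem hP' hQ')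
    refine ⟨⟨P, hP, ?_⟩, ⟨Q, hQ, ?_⟩⟩
    · rw [← hψ₁ Q hQ, hPQ, ptraceRight_kron P' hQ'.2]
    · rw [← hψ₂ P hP, hPQ, ptraceLeft_kron Q' hP'.2]
  obtain ⟨hψP₀, hψQ₀, -⟩ := hmem P₀ hP₀ Q₀ hQ₀
  refine ⟨ψ₁, ψ₂, ?_, ?_, fun A B => ?_⟩
  · exact Set.Subset.antisymm (Set.image_subset_iff.2 fun P hP => (hmem P hP Q₀ hQ₀).1)
      fun P' hP' => (hsurj P' hP' _ hψQ₀).1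
  · exact Set.Subset.antisymm (Set.image_subset_iff.2 fun Q hQ => (hmem P₀ hP₀ Q hQ).2.1)
      fun Q' hQ' => (hsurj _ hψP₀ Q' hQ').2
  · exact LinearMap.congr_fun₂ (ext_pureStates (f := T) (g := (kronₗ m n).compl₁₂ ψ₁ ψ₂)
      fun P hP Q hQ => (hmem P hP Q hQ).2.2.symm) A B

theorem subsingleton_image_productPure {E : Type*} [AddCommGroup E] [Module ℝ E]
    {T : Herm (Fin k) →ₗ[ℝ] Herm (Fin l) →ₗ[ℝ] Herm (Fin m × Fin n)}
    (hT : Set.image2 (fun A B => T A B) (pureStates k) (pureStates l) = productPure m n)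
    {f : Herm (Fin m × Fin n) →ₗ[ℝ] E} (h₁ : (T.compr₂ f '' pureStates k).Subsingleton)
    (h₂ : (T.flip.compr₂ f '' pureStates l).Subsingleton) :
    (f '' productPure m n).Subsingleton := by
  rw [← hT]
  rintro _ ⟨_, ⟨P, hP, Q, hQ, rfl⟩, rfl⟩ _ ⟨_, ⟨P', hP', Q', hQ', rfl⟩, rfl⟩
  calc f (T P Q) = f (T P' Q) := LinearMap.congr_fun
        (h₁ (Set.mem_image_of_mem _ hP) (Set.mem_image_of_mem _ hP')) Q
    _ = f (T P' Q') := LinearMap.congr_fun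
        (h₂ (Set.mem_image_of_mem _ hQ) (Set.mem_image_of_mem _ hQ')) P'

theorem image_ptraceRight_productPure [NeZero n] :
    ptraceRight m n '' productPure m n = pureStates m := by
  rw [productPure, Set.image_image2, Set.image2_congr fun P _ Q hQ => ptraceRight_kron P hQ.2,
    Set.image2_left pureStates_nonempty]

theorem image_ptraceLeft_productPure [NeZero m] :
    ptraceLeft m n '' productPure m n = pureStates n := by
  rw [productPure, Set.image_image2, Set.image2_congr fun P hP Q _ => ptraceLeft_kron Q hP.2,
    Set.image2_right pureStates_nonempty]

theorem exists_eq_kron_or_eq_kron_swap {Ψ : Herm (Fin m × Fin n) →ₗ[ℝ] Herm (Fin m × Fin n)}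
    (hΨ : Ψ '' productPure m n = productPure m n) :
    (∃ (ψ₁ : Herm (Fin m) →ₗ[ℝ] Herm (Fin m)) (ψ₂ : Herm (Fin n) →ₗ[ℝ] Herm (Fin n)),
      ψ₁ '' pureStates m = pureStates m ∧ ψ₂ '' pureStates n = pureStates n ∧
        ∀ A B, Ψ (kron A B) = kron (ψ₁ A) (ψ₂ B)) ∨
    ∃ (ψ₁ : Herm (Fin m) →ₗ[ℝ] Herm (Fin n)) (ψ₂ : Herm (Fin n) →ₗ[ℝ] Herm (Fin m)),
      ψ₁ '' pureStates m = pureStates n ∧ ψ₂ '' pureStates n = pureStates m ∧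
        ∀ A B, Ψ (kron A B) = kron (ψ₂ B) (ψ₁ A) := by
  rcases isEmpty_or_nonempty (Fin m × Fin n) with _ | hne
  · exact Or.inl ⟨.id, .id, Set.image_id _, Set.image_id _, fun _ _ => Subsingleton.elim _ _⟩
  obtain ⟨⟨i⟩, ⟨j⟩⟩ := nonempty_prod.1 hne
  have : NeZero m := ⟨i.pos.ne'⟩
  have : NeZero n := ⟨j.pos.ne'⟩
  let T := (kronₗ m n).compr₂ Ψ
  have hT : Set.image2 (fun A B => T A B) (pureStates m) (pureStates n) = productPure m n :=
    (Set.image_image2 kron Ψ).symm.trans hΨ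
  have hTflip : Set.image2 (fun B A => T.flip B A) (pureStates n) (pureStates m) =
      productPure m n := (Set.image2_swap _ _ _).symm.trans hT
  have hmem : ∀ P ∈ pureStates m, ∀ Q ∈ pureStates n, T P Q ∈ productPure m n :=
    fun P hP Q hQ => hT.le (Set.mem_image2_of_mem hP hQ)
  have hsplit := exists_eq_kron hT
  have hswap := exists_eq_kron hTflip
  rcases subsingleton_image_ptraceRight_or_ptraceLeft hmem with hP | hP <;>
  rcases subsingleton_image_ptraceRight_or_ptraceLeft (T := T.flip)
    (fun Q hQ P hP => hmem P hP Q hQ) with hQ | hQ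
  · have hm := subsingleton_image_productPure hT hP hQ
    rw [image_ptraceRight_productPure] at hm
    exact Or.inl (hsplit hQ (hm.image _))
  · obtain ⟨ψ₂, ψ₁, h₂, h₁, hψ⟩ := hswap hP hQ
    exact Or.inr ⟨ψ₁, ψ₂, h₁, h₂, fun A B => hψ B A⟩
  · exact Or.inl (hsplit hQ hP)
  · have hn := subsingleton_image_productPure hT hP hQ
    rw [image_ptraceLeft_productPure] at hn
    exact Or.inl (hsplit (hn.image _) hP)

end Splitting

section Complexification

open scoped ComplexStarModule

section Module

variable {A B : Type*} [AddCommGroup A] [Module ℂ A] [StarAddMonoid A] [StarModule ℂ A]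
  [AddCommGroup B] [Module ℂ B] [StarAddMonoid B] [StarModule ℂ B]

/-- The complex-linear extension of a real-linear map between self-adjoint parts. -/
noncomputable def complexify (ψ : selfAdjoint A →ₗ[ℝ] selfAdjoint B) : A →ₗ[ℂ] B where
  toFun a := ψ (ℜ a) + Complex.I • (ψ (ℑ a) : B)
  map_add' a b := by
    simp only [map_add, AddSubgroup.coe_add, smul_add]
    abel
  map_smul' c a := by
    simp only [realPart_smul, imaginaryPart_smul, map_sub, map_add, map_smul, AddSubgroup.coe_sub,
      AddSubgroup.coe_add, selfAdjoint.val_smul, ← Complex.coe_smul, RingHom.id_apply]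
    nth_rw 5 [← Complex.re_add_im c]
    match_scalars
    · ring
    · linear_combination -(c.im : ℂ) * Complex.I_sq

theorem complexify_apply (ψ : selfAdjoint A →ₗ[ℝ] selfAdjoint B) (a : A) :
    complexify ψ a = ψ (ℜ a) + Complex.I • (ψ (ℑ a) : B) := rfl

theorem complexify_coe (ψ : selfAdjoint A →ₗ[ℝ] selfAdjoint B) (a : selfAdjoint A) :
    complexify ψ a = ψ a := by
  simp [complexify_apply, selfAdjoint.realPart_coe, selfAdjoint.imaginaryPart_coe]

theorem complexify_star (ψ : selfAdjoint A →ₗ[ℝ] selfAdjoint B) (a : A) :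
    complexify ψ (star a) = star (complexify ψ a) := by
  rw [← realPart_add_I_smul_imaginaryPart a]
  simp only [star_add, star_smul, map_add, map_smul, selfAdjoint.star_val_eq, complexify_coe]

theorem complexify_surjective {ψ : selfAdjoint A →ₗ[ℝ] selfAdjoint B} (hψ : Function.Surjective ψ) :
    Function.Surjective (complexify ψ) := fun b => by
  obtain ⟨x, hx⟩ := hψ (ℜ b)
  obtain ⟨y, hy⟩ := hψ (ℑ b)
  refine ⟨x + Complex.I • (y : A), ?_⟩
  rw [map_add, map_smul, complexify_coe, complexify_coe, hx, hy, realPart_add_I_smul_imaginaryPart]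

end Module

theorem isJordanHom_complexify {A B : Type*} [Ring A] [StarRing A] [Algebra ℂ A] [StarModule ℂ A]
    [Ring B] [StarRing B] [Algebra ℂ B] [StarModule ℂ B] {ψ : selfAdjoint A →ₗ[ℝ] selfAdjoint B}
    (hψ : ∀ a, ψ (a ^ 2) = ψ a ^ 2) : IsJordanHom (complexify ψ : A →+ B) := fun a => by
  have hsq : ∀ x : selfAdjoint A, complexify ψ (x * x : A) = complexify ψ x * complexify ψ x :=
    fun x => by
      rw [← sq, ← selfAdjoint.val_pow, complexify_coe, hψ, selfAdjoint.val_pow, sq, complexify_coe]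
  set φ := complexify ψ
  have hadd : φ (ℜ a * ℑ a) + φ (ℑ a * ℜ a) = φ (ℜ a) * φ (ℑ a) + φ (ℑ a) * φ (ℜ a) := by
    have h := hsq (ℜ a + ℑ a)
    simp only [AddSubgroup.coe_add, add_mul, mul_add, map_add, hsq] at h
    linear_combination (norm := module) h
  change φ (a * a) = φ a * φ a
  rw [← realPart_add_I_smul_imaginaryPart a]
  simp only [add_mul, mul_add, map_add, hsq, map_smul, smul_mul_assoc, mul_smul_comm]
  linear_combination (norm := module) Complex.I • hadd

end Complexification

section MatrixAutomorphism

variable {ι 𝕜 : Type*} [Fintype ι] [DecidableEq ι] [RCLike 𝕜]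

theorem exists_mem_unitaryGroup_eq_conj (φ : Matrix ι ι 𝕜 →ₗ[𝕜] Matrix ι ι 𝕜)
    (hφ : Function.Surjective φ) (hmul : ∀ A B, φ (A * B) = φ A * φ B)
    (hstar : ∀ A, φ (star A) = star (φ A)) :
    ∃ U ∈ unitaryGroup ι 𝕜, ∀ A, φ A = U * A * Uᴴ := by
  let f : Matrix ι ι 𝕜 ≃⋆ₐ[𝕜] Matrix ι ι 𝕜 :=
    { LinearEquiv.ofBijective φ ⟨LinearMap.injective_iff_surjective.2 hφ, hφ⟩ with
      map_mul' := hmul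
      map_star' := hstar
      map_smul' := map_smul φ }
  let e : Matrix ι ι 𝕜 ≃⋆ₐ[𝕜] (EuclideanSpace 𝕜 ι →L[𝕜] EuclideanSpace 𝕜 ι) := toEuclideanCLM
  let g := (e.symm.trans f).trans e
  have hg : Continuous g := (LinearMapClass.linearMap g).continuous_of_finiteDimensional
  obtain ⟨u, hu⟩ := g.eq_linearIsometryEquivConjStarAlgEquiv hg
  rw [← Unitary.conjStarAlgAut_symm_unitaryLinearIsometryEquiv] at hu
  obtain ⟨U, hU⟩ := EquivLike.surjective e (Unitary.linearIsometryEquiv.symm u).1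
  have hconj : ∀ A, f A = U * A * Uᴴ := fun A => e.injective <| calc
    e (f A) = g (e A) := by simp [g]
    _ = e U * e A * star (e U) := by rw [hu, hU]; rfl
    _ = e (U * A * Uᴴ) := by rw [← star_eq_conjTranspose, map_mul, map_mul, map_star]
  refine ⟨U, mem_unitaryGroup_iff.2 ?_, hconj⟩
  simpa only [map_one, mul_one, star_eq_conjTranspose] using (hconj 1).symm

end MatrixAutomorphism

section PureStateMaps

variable {m n : ℕ}

theorem traceForm_pure_nonneg {P Q : Herm (Fin n)} (hP : P ∈ pureStates n)
    (hQ : Q ∈ pureStates n) : 0 ≤ traceForm P Q := by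
  obtain ⟨x, -, rfl⟩ := mem_pureStates_iff.1 hP
  obtain ⟨y, -, rfl⟩ := mem_pureStates_iff.1 hQ
  exact posSemidef_iff_traceForm_rankOne_nonneg.1 (posSemidef_vecMulVec_self_star x) y

theorem traceForm_pure_le_one {P Q : Herm (Fin n)} (hP : P ∈ pureStates n)
    (hQ : Q ∈ pureStates n) : traceForm P Q ≤ 1 := by
  have h := traceForm_self_nonneg (P - Q)
  simp only [map_sub, LinearMap.sub_apply, traceForm_pure_self hP, traceForm_pure_self hQ,
    traceForm_comm Q P] at h
  linarith

theorem posSemidef_of_traceForm_pure_nonneg {X : Herm (Fin n)}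
    (h : ∀ P ∈ pureStates n, 0 ≤ traceForm X P) : (X : Matrix (Fin n) (Fin n) ℂ).PosSemidef := by
  refine posSemidef_iff_traceForm_rankOne_nonneg.2 fun x => ?_
  rcases eq_or_ne x 0 with rfl | hx
  · have hzero : rankOne (0 : Fin n → ℂ) = 0 := Subtype.ext (zero_vecMulVec _)
    rw [hzero, map_zero]
  · obtain ⟨P, hP, hxP⟩ := exists_pureState_smul_eq_rankOne hx
    rw [hxP, map_smul]
    exact mul_nonneg (traceForm_one_rankOne_pos hx).le (h P hP)

theorem posSemidef_sub_rankOne {X : Herm (Fin n)} {x : Fin n → ℂ}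
    (hX : (X : Matrix (Fin n) (Fin n) ℂ).PosSemidef)
    (hX1 : (1 - X : Matrix (Fin n) (Fin n) ℂ).PosSemidef) (hx : star x ⬝ᵥ x = 1)
    (hXx : traceForm X (rankOne x) = 1) :
    (X - rankOne x : Matrix (Fin n) (Fin n) ℂ).PosSemidef := by
  set E := (rankOne x : Matrix (Fin n) (Fin n) ℂ) with hE
  have hEh : Eᴴ = E := (rankOne x).isHermitian
  have hfix : (X : Matrix (Fin n) (Fin n) ℂ) *ᵥ x = x := by
    have hzero : (1 - X : Matrix (Fin n) (Fin n) ℂ) *ᵥ x = 0 := by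
      rw [← hX1.dotProduct_mulVec_zero_iff, sub_mulVec, one_mulVec, dotProduct_sub, hx,
        ← coe_traceForm_rankOne, hXx, Complex.ofReal_one, sub_self]
    rwa [sub_mulVec, one_mulVec, sub_eq_zero, eq_comm] at hzero
  have hXE : X * E = E := by rw [hE, coe_rankOne, mul_vecMulVec, hfix]
  have hEX : E * X = E := by
    have h := congrArg conjTranspose hXE
    rwa [conjTranspose_mul, hEh, X.isHermitian] at h
  have hEE : E * E = E := by rw [hE, rankOne_mul_rankOne, hx, one_smul, coe_rankOne]
  have hcompress : (1 - E)ᴴ * X.1 * (1 - E) = X.1 - E := by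
    rw [conjTranspose_sub, conjTranspose_one, hEh, sub_mul, one_mul, hEX, mul_sub, mul_one, sub_mul,
      hXE, hEE, sub_self, sub_zero]
  exact hcompress ▸ hX.conjTranspose_mul_mul_same (1 - E)

/-- The pullback of `tr (ψ P ·)` along `ψ` is `tr (X ·)` with `0 ≤ X ≤ 1` and `tr (X P) = 1`, and
`P` is the smallest such `X`. -/
theorem traceForm_le_traceForm_map {ψ : Herm (Fin m) →ₗ[ℝ] Herm (Fin n)}
    (hψ : Set.MapsTo ψ (pureStates m) (pureStates n)) {P Q : Herm (Fin m)}
    (hP : P ∈ pureStates m) (hQ : Q ∈ pureStates m) :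
    traceForm P Q ≤ traceForm (ψ P) (ψ Q) := by
  obtain ⟨X, hX⟩ := exists_traceForm_eq (traceForm (ψ P) ∘ₗ ψ)
  simp only [LinearMap.comp_apply] at hX
  have hX0 := posSemidef_of_traceForm_pure_nonneg (X := X) fun R hR => by
    rw [hX]
    exact traceForm_pure_nonneg (hψ hP) (hψ hR)
  have hX1 := posSemidef_of_traceForm_pure_nonneg (X := 1 - X) fun R hR => by
    rw [map_sub, LinearMap.sub_apply, traceForm_one_of_mem_pureStates hR, hX, sub_nonneg]
    exact traceForm_pure_le_one (hψ hP) (hψ hR)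
  have hXP : traceForm X P = 1 := by rw [hX, traceForm_pure_self (hψ hP)]
  obtain ⟨x, hx, rfl⟩ := mem_pureStates_iff.1 hP
  obtain ⟨y, -, rfl⟩ := mem_pureStates_iff.1 hQ
  have h := posSemidef_iff_traceForm_rankOne_nonneg (A := X - rankOne x).1
    (posSemidef_sub_rankOne hX0 hX1 hx hXP) y
  rwa [map_sub, LinearMap.sub_apply, sub_nonneg, hX] at h

theorem exists_pureStates_sum_eq_one (n : ℕ) :
    ∃ E : Fin n → Herm (Fin n), (∀ i, E i ∈ pureStates n) ∧ ∑ i, E i = 1 := by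
  refine ⟨fun i => rankOne (Pi.single i 1), fun i => rankOne_mem_pureStates (by simp), ?_⟩
  ext a b
  simp [coe_rankOne, vecMulVec_apply, Matrix.sum_apply, one_apply, Pi.single_apply]

theorem le_of_image_pureStates_eq {ψ : Herm (Fin m) →ₗ[ℝ] Herm (Fin n)}
    (hψ : ψ '' pureStates m = pureStates n) : n ≤ m := by
  have hmaps : Set.MapsTo ψ (pureStates m) (pureStates n) := Set.mapsTo_iff_image_subset.2 hψ.le
  obtain ⟨E, hE, hE1⟩ := exists_pureStates_sum_eq_one m
  obtain ⟨F, hF, hF1⟩ := exists_pureStates_sum_eq_one n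
  have hone : ∀ R ∈ pureStates n, 1 ≤ traceForm R (ψ 1) := by
    rw [← hψ]
    rintro _ ⟨P, hP, rfl⟩
    calc 1 = ∑ i, traceForm P (E i) := by
          rw [← map_sum, hE1, traceForm_comm, traceForm_one_of_mem_pureStates hP]
      _ ≤ ∑ i, traceForm (ψ P) (ψ (E i)) :=
          Finset.sum_le_sum fun i _ => traceForm_le_traceForm_map hmaps hP (hE i)
      _ = traceForm (ψ P) (ψ 1) := by rw [← hE1, map_sum, map_sum]
  have hreal : (n : ℝ) ≤ m := calc
    (n : ℝ) = ∑ _j : Fin n, 1 := by simp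
    _ ≤ ∑ j, traceForm (F j) (ψ 1) := Finset.sum_le_sum fun j _ => hone _ (hF j)
    _ = ∑ i, traceForm 1 (ψ (E i)) := by
      rw [← LinearMap.sum_apply, ← map_sum, hF1, ← hE1, map_sum, map_sum]
    _ = m := by simp [traceForm_one_of_mem_pureStates (hmaps (hE _))]
  exact_mod_cast hreal

end PureStateMaps

section Wigner

variable {n : ℕ} {ψ : Herm (Fin n) →ₗ[ℝ] Herm (Fin n)}

theorem surjective_of_image_pureStates_eq (hψ : ψ '' pureStates n = pureStates n) :
    Function.Surjective ψ := by
  rw [← LinearMap.range_eq_top, ← Submodule.map_top, ← span_pureStates, Submodule.map_span, hψ]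

theorem traceForm_map_map (hψ : ψ '' pureStates n = pureStates n) {P Q : Herm (Fin n)}
    (hP : P ∈ pureStates n) (hQ : Q ∈ pureStates n) :
    traceForm (ψ P) (ψ Q) = traceForm P Q := by
  have hmaps : Set.MapsTo ψ (pureStates n) (pureStates n) := Set.mapsTo_iff_image_subset.2 hψ.le
  obtain ⟨φ, hφ⟩ := ψ.exists_leftInverse_of_injective <| LinearMap.ker_eq_bot.2 <|
    LinearMap.injective_iff_surjective.2 (surjective_of_image_pureStates_eq hψ)
  have hφψ : ∀ A, φ (ψ A) = A := LinearMap.congr_fun hφ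
  have hφ_maps : Set.MapsTo φ (pureStates n) (pureStates n) := fun R hR => by
    obtain ⟨S, hS, rfl⟩ := hψ.ge hR
    rwa [hφψ]
  refine le_antisymm ?_ (traceForm_le_traceForm_map hmaps hP hQ)
  simpa only [hφψ] using traceForm_le_traceForm_map hφ_maps (hmaps hP) (hmaps hQ)

theorem orthogonalIdempotents_iff_traceForm_eq_zero {ι : Type*} {P : ι → Herm (Fin n)}
    (hP : ∀ i, P i ∈ pureStates n) :
    OrthogonalIdempotents (fun i => (P i : Matrix (Fin n) (Fin n) ℂ)) ↔
      Pairwise fun i j => traceForm (P i) (P j) = 0 := by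
  choose x hx hPx using fun i => mem_pureStates_iff.1 (hP i)
  have hmul : ∀ i j, (P i * P j : Matrix (Fin n) (Fin n) ℂ) =
      (star (x i) ⬝ᵥ x j) • vecMulVec (x i) (star (x j)) := fun i j => by
    rw [hPx, hPx, rankOne_mul_rankOne]
  refine ⟨fun h i j hij => ?_, fun h => ⟨fun i => ?_, fun i j hij => ?_⟩⟩
  · apply Complex.ofReal_injective
    rw [coe_traceForm, h.ortho hij, trace_zero, Complex.ofReal_zero]
  · rw [IsIdempotentElem, hmul, hx, one_smul, ← coe_rankOne, ← hPx]
  · have hzero := coe_traceForm (P i) (P j)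
    rw [h hij, hmul, trace_smul, trace_vecMulVec, dotProduct_star, dotProduct_comm (x j),
      smul_eq_mul, Complex.ofReal_zero, eq_comm, CStarRing.mul_star_self_eq_zero_iff] at hzero
    exact (hmul i j).trans (by rw [hzero, zero_smul])

theorem exists_orthogonal_pureStates (A : Herm (Fin n)) :
    ∃ (c : Fin n → ℝ) (P : Fin n → Herm (Fin n)), (∀ i, P i ∈ pureStates n) ∧
      OrthogonalIdempotents (fun i => (P i : Matrix (Fin n) (Fin n) ℂ)) ∧ A = ∑ i, c i • P i := by
  obtain ⟨u, hu, hA⟩ := A.exists_spectral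
  refine ⟨_, fun i => rankOne (u i), fun i => rankOne_mem_pureStates ?_, ⟨fun i => ?_, ?_⟩, hA⟩
  · rw [hu, one_apply_eq]
  · rw [IsIdempotentElem, rankOne_mul_rankOne, hu, one_apply_eq, one_smul, coe_rankOne]
  · intro i j hij
    rw [rankOne_mul_rankOne, hu, one_apply_ne hij, zero_smul]

theorem sq_sum_smul_of_orthogonalIdempotents {ι R A : Type*} [Fintype ι] [CommSemiring R]
    [Semiring A] [Algebra R A] {e : ι → A} (he : OrthogonalIdempotents e) (c : ι → R) :
    (∑ i, c i • e i) ^ 2 = ∑ i, c i ^ 2 • e i := by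
  classical
  simp only [sq, Finset.sum_mul_sum, smul_mul_smul_comm, he.mul_eq, smul_ite, smul_zero,
    Finset.sum_ite_eq, Finset.mem_univ, if_true]

theorem map_sq_of_image_pureStates_eq (hψ : ψ '' pureStates n = pureStates n) (A : Herm (Fin n)) :
    ψ (A ^ 2) = ψ A ^ 2 := by
  obtain ⟨c, P, hP, hPo, rfl⟩ := exists_orthogonal_pureStates A
  have hψP : ∀ i, ψ (P i) ∈ pureStates n := fun i => hψ ▸ Set.mem_image_of_mem ψ (hP i)
  have hψPo := (orthogonalIdempotents_iff_traceForm_eq_zero hψP).2 fun i j hij =>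
    (traceForm_map_map hψ (hP i) (hP j)).trans
      ((orthogonalIdempotents_iff_traceForm_eq_zero hP).1 hPo hij)
  have hsq : ∀ {Q : Fin n → Herm (Fin n)},
      OrthogonalIdempotents (fun i => (Q i : Matrix (Fin n) (Fin n) ℂ)) →
        (∑ i, c i • Q i) ^ 2 = ∑ i, c i ^ 2 • Q i := fun hQ => Subtype.ext <| by
    simpa only [selfAdjoint.val_pow, AddSubgroup.val_finsetSum, selfAdjoint.val_smul] using
      sq_sum_smul_of_orthogonalIdempotents hQ c
  simp only [hsq hPo, map_sum, map_smul, hsq hψPo]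

theorem exists_isUnitaryForm (hψ : ψ '' pureStates n = pureStates n) :
    ∃ U ∈ unitaryGroup (Fin n) ℂ, IsUnitaryForm U ψ := by
  have : IsAddTorsionFree (Matrix (Fin n) (Fin n) ℂ) := .of_isTorsionFree ℂ _
  have hsurj := complexify_surjective (surjective_of_image_pureStates_eq hψ)
  rcases (isJordanHom_complexify (map_sq_of_image_pureStates_eq hψ)).map_mul_or_map_mul_swap
    hsurj (isPrimeRing_matrix _ _) with hmul | hmul
  · obtain ⟨U, hU, h⟩ := exists_mem_unitaryGroup_eq_conj (complexify ψ) hsurj hmul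
      (complexify_star ψ)
    exact ⟨U, hU, Or.inl fun A => by rw [← h, complexify_coe]⟩
  · obtain ⟨U, hU, h⟩ := exists_mem_unitaryGroup_eq_conj
      (complexify ψ ∘ₗ (transposeLinearEquiv (Fin n) (Fin n) ℂ ℂ).toLinearMap)
      (hsurj.comp (transposeLinearEquiv (Fin n) (Fin n) ℂ ℂ).surjective)
      (fun A B => by simpa using! hmul Bᵀ Aᵀ)
      (fun A => complexify_star ψ Aᵀ)
    refine ⟨U, hU, Or.inr fun A => ?_⟩
    rw [← h, ← complexify_coe]
    rfl

end Wigner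

section UnitaryForm

variable {n : ℕ} {U : Matrix (Fin n) (Fin n) ℂ} {ψ : Herm (Fin n) → Herm (Fin n)}

theorem mem_pureStates_iff_of_isUnitaryForm (hU : U ∈ unitaryGroup (Fin n) ℂ)
    (hψ : IsUnitaryForm U ψ) {A : Herm (Fin n)} : ψ A ∈ pureStates n ↔ A ∈ pureStates n := by
  have hUU : Uᴴ * U = 1 := mem_unitaryGroup_iff'.1 hU
  have hdet : IsUnit U.det := isUnit_det_of_left_inverse hUU
  have hdet' : IsUnit Uᴴ.det := isUnit_det_of_right_inverse hUU
  have hrank : ∀ M : Matrix (Fin n) (Fin n) ℂ, (U * M * Uᴴ).rank = M.rank := fun M => by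
    rw [rank_mul_eq_left_of_isUnit_det _ _ hdet', rank_mul_eq_right_of_isUnit_det _ _ hdet]
  have htrace : ∀ M : Matrix (Fin n) (Fin n) ℂ, (U * M * Uᴴ).trace = M.trace := fun M => by
    rw [trace_mul_comm, ← Matrix.mul_assoc, hUU, Matrix.one_mul]
  rcases hψ with h | h <;>
    simp only [pureStates, Set.mem_ofPred_eq, h A, hrank, htrace, rank_transpose, trace_transpose]

theorem surjective_of_isUnitaryForm (hU : U ∈ unitaryGroup (Fin n) ℂ) (hψ : IsUnitaryForm U ψ) :
    Function.Surjective ψ := fun B => by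
  have hUU : U * Uᴴ = 1 := mem_unitaryGroup_iff.1 hU
  have hB : (Uᴴ * B.1 * U).IsHermitian := isHermitian_conjTranspose_mul_mul U B.isHermitian
  have hconj : U * (Uᴴ * B.1 * U) * Uᴴ = B := calc
    U * (Uᴴ * B.1 * U) * Uᴴ = (U * Uᴴ) * B.1 * (U * Uᴴ) := by simp only [Matrix.mul_assoc]
    _ = B := by rw [hUU, Matrix.one_mul, Matrix.mul_one]
  rcases hψ with h | h
  · exact ⟨⟨_, hB⟩, Subtype.ext ((h _).trans hconj)⟩
  · exact ⟨⟨_, hB.transpose⟩, Subtype.ext ((h _).trans (by rw [transpose_transpose, hconj]))⟩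

theorem image_pureStates_of_isUnitaryForm (hU : U ∈ unitaryGroup (Fin n) ℂ)
    (hψ : IsUnitaryForm U ψ) : ψ '' pureStates n = pureStates n := by
  have hpre : ψ ⁻¹' pureStates n = pureStates n :=
    Set.ext fun _ => mem_pureStates_iff_of_isUnitaryForm hU hψ
  conv_lhs => rw [← hpre]
  exact Set.image_preimage_eq _ (surjective_of_isUnitaryForm hU hψ)

end UnitaryForm

end SepStates

theorem theorem2p3 (m n : ℕ)
    (Ψ : SepStates.Herm (Fin m × Fin n) →ₗ[ℝ] SepStates.Herm (Fin m × Fin n)) :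
    List.TFAE [
      Ψ '' SepStates.productPure m n = SepStates.productPure m n,
      Ψ '' SepStates.separable m n = SepStates.separable m n,
      ∃ U ∈ Matrix.unitaryGroup (Fin m) ℂ, ∃ V ∈ Matrix.unitaryGroup (Fin n) ℂ,
      ∃ ψ₁ : SepStates.Herm (Fin m) → SepStates.Herm (Fin m),
      ∃ ψ₂ : SepStates.Herm (Fin n) → SepStates.Herm (Fin n),
        SepStates.IsUnitaryForm U ψ₁ ∧ SepStates.IsUnitaryForm V ψ₂ ∧
        ((∀ (A : SepStates.Herm (Fin m)) (B : SepStates.Herm (Fin n)),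
            Ψ (SepStates.kron A B) = SepStates.kron (ψ₁ A) (ψ₂ B)) ∨
         (∃ h : m = n, ∀ (A : SepStates.Herm (Fin m)) (B : SepStates.Herm (Fin n)),
            Ψ (SepStates.kron A B) =
              SepStates.kron (SepStates.castHerm h.symm (ψ₂ B))
                (SepStates.castHerm h (ψ₁ A))))] := by
  open SepStates in
  tfae_have 1 ↔ 2 := image_productPure_eq_iff_image_separable_eq Ψ
  tfae_have 1 → 3 := by
    intro hΨ
    rcases exists_eq_kron_or_eq_kron_swap hΨ with
      ⟨ψ₁, ψ₂, h₁, h₂, hk⟩ | ⟨ψ₁, ψ₂, h₁, h₂, hk⟩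
    · obtain ⟨U, hU, hUψ⟩ := exists_isUnitaryForm h₁
      obtain ⟨V, hV, hVψ⟩ := exists_isUnitaryForm h₂
      exact ⟨U, hU, V, hV, ψ₁, ψ₂, hUψ, hVψ, Or.inl hk⟩
    · obtain rfl : m = n :=
        le_antisymm (le_of_image_pureStates_eq h₂) (le_of_image_pureStates_eq h₁)
      obtain ⟨U, hU, hUψ⟩ := exists_isUnitaryForm h₁
      obtain ⟨V, hV, hVψ⟩ := exists_isUnitaryForm h₂
      exact ⟨U, hU, V, hV, ψ₁, ψ₂, hUψ, hVψ, Or.inr ⟨rfl, hk⟩⟩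
  tfae_have 3 → 1 := by
    rintro ⟨U, hU, V, hV, ψ₁, ψ₂, hUψ, hVψ, hk⟩
    have h₁ := image_pureStates_of_isUnitaryForm hU hUψ
    have h₂ := image_pureStates_of_isUnitaryForm hV hVψ
    rcases hk with hk | ⟨rfl, hk⟩
    · rw [productPure, Set.image_image2_distrib hk, h₁, h₂]
    · rw [productPure, Set.image_image2_antidistrib (g₁ := ψ₂) (g₂ := ψ₁) hk, h₁, h₂]
  tfae_finish
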